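/- Let $A\in\mathbb R^{n\times n}$, $B\in\mathbb R^{n\times k}$, $D\in\mathbb R^{n\times m}$, $E\in\mathbb R^{m\times n}$, $F\in\mathbb R^{m\times m}$, $c\in\mathbb R^m$, and consider the linear complementarity system $$\dot x=Ax+Bu+D\lambda,\qquad 0\le\lambda\perp Ex+F\lambda+c\ge 0 ,$$ where $0\le a\perp b\ge0$ means $a\ge0$, $b\ge0$ componentwise and $a^Tb=0$. Let $\mathrm{SOL}(w,F)=\{\lambda: 0\le\lambda\perp F\lambda+w\ge0\}$. Assume that $F$ is a P-matrix (all its principal minors are positive) and that $c\ge0$, and let $K\in\mathbb R^{k\times n}$, $L\in\mathbb R^{k\times m}$. Then for every $x$ the set $\mathrm{SOL}(Ex+c,F)$ has exactly one element $\lambda(x)$, and the one-sided directional derivative $\lambda'(x;d)=\lim_{t\downarrow0}\big(\lambda(x+td)-\lambda(x)\big)/t$ exists for all $x,d\in\mathbb R^n$. The input $u=Kx+L\lambda(x)$ is a continuous function of $x$, and the system is globally Lipschitz continuous: the maps $(x,u)\mapsto Ax+Bu+D\lambda(x)$ and $x\mapsto Ax+B(Kx+L\lambda(x))+D\lambda(x)$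 are Lipschitz. Furthermore, let $P\in\mathbb R^{n\times n}$ be symmetric, $Q\in\mathbb R^{n\times m}$, $R\in\mathbb R^{m\times m}$, and put $$M=\begin{bmatrix}P&Q\\Q^T&R\end{bmatrix},\qquad N=\begin{bmatrix}N_{11}&N_{12}&Q\\N_{12}^T&N_{22}&R\\Q^T&R&0\end{bmatrix},$$ $$N_{11}=A^TP+PA+K^TB^TP+PBK,\qquad N_{12}=PBL+PD+A^TQ+K^TB^TQ,$$ $$N_{22}=L^TB^TQ+D^TQ+Q^TD+Q^TBL,$$ and $V(x,\lambda)=\begin{bmatrix}x\\\lambda\end{bmatrix}^TM\begin{bmatrix}x\\\lambda\end{bmatrix}$. Let $\mathcal D\subseteq\mathbb R^n$ be a neighbourhood of the origin such that $V(x,\lambda(x))>0$ for all $x\in\mathcal D\setminus\{0\}$. For $x\in\mathbb R^n$ write $f(x)=Ax+B(Kx+L\lambda(x))+D\lambda(x)$, $\bar\lambda(x)=\lambda'(x;f(x))$ and $z(x)=(x,\lambda(x),\bar\lambda(x))$. Then, for the closed loop with $u=Kx+L\lambda$: 1. if $z(x)^TNz(x)\le0$ for all $x\in\mathcal D$, the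 origin is a Lyapunov stable equilibrium: for every $\varepsilon>0$ there is $\delta>0$ such that every solution on $[0,\infty)$ with $\|x(0)\|<\delta$ satisfies $\|x(t)\|<\varepsilon$ for all $t\ge0$; 2. if $z(x)^TNz(x)<0$ for all $x\in\mathcal D\setminus\{0\}$, the origin is asymptotically stable: it is Lyapunov stable, and there is $\delta>0$ such that every solution on $[0,\infty)$ with $\|x(0)\|<\delta$ satisfies $x(t)\to0$ as $t\to\infty$. -/

import Mathlib

open scoped Matrix Topology NNReal

namespace LCS

/-- A real square matrix is a P-matrix if all its principal minors are positive. -/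
def IsPMatrix {m : ℕ} (F : Matrix (Fin m) (Fin m) ℝ) : Prop :=
  ∀ α : Finset (Fin m),
    0 < (F.submatrix (fun i : {j // j ∈ α} => (i : Fin m)) (fun i : {j // j ∈ α} => (i : Fin m))).det

/-- The solution set `SOL(w, F)` of the linear complementarity problem
`0 ≤ l ⟂ F l + w ≥ 0` (inequalities between vectors are componentwise). -/
def SOL {m : ℕ} (w : Fin m → ℝ) (F : Matrix (Fin m) (Fin m) ℝ) : Set (Fin m → ℝ) :=
  {l | 0 ≤ l ∧ 0 ≤ F *ᵥ l + w ∧ l ⬝ᵥ (F *ᵥ l + w) = 0}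

/-- The contact force `λ(x)`: the element of `SOL(E x + c, F)`.
(It is the unique one when `F` is a P-matrix; otherwise it is a choice of one, if there is any.) -/
noncomputable def contactForce {n m : ℕ} (E : Matrix (Fin m) (Fin n) ℝ)
    (F : Matrix (Fin m) (Fin m) ℝ) (c : Fin m → ℝ) (x : Fin n → ℝ) : Fin m → ℝ :=
  Classical.epsilon fun l : Fin m → ℝ => l ∈ SOL (E *ᵥ x + c) F

/-- `v` is the one-sided directional derivative `f'(x; d)` of `f` at `x` in the direction `d`. -/
def HasDirDeriv {n m : ℕ} (f : (Fin n → ℝ) → (Fin m → ℝ)) (x d : Fin n → ℝ)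
    (v : Fin m → ℝ) : Prop :=
  Filter.Tendsto (fun t : ℝ => t⁻¹ • (f (x + t • d) - f x)) (𝓝[>] 0) (𝓝 v)

/-- `Γ_SOL(E, F, c)`, the graph of `λ(x)`. -/
def graphSOL {n m : ℕ} (E : Matrix (Fin m) (Fin n) ℝ) (F : Matrix (Fin m) (Fin m) ℝ)
    (c : Fin m → ℝ) : Set ((Fin n → ℝ) × (Fin m → ℝ)) :=
  {p | p.2 ∈ SOL (E *ᵥ p.1 + c) F}

/-- `Γ'_SOL(E, F, c, d)`, the graph of `x ↦ (λ(x), λ'(x; d))`. -/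
def graphSOL' {n m : ℕ} (E : Matrix (Fin m) (Fin n) ℝ) (F : Matrix (Fin m) (Fin m) ℝ)
    (c : Fin m → ℝ) (d : Fin n → ℝ) : Set ((Fin n → ℝ) × (Fin m → ℝ) × (Fin m → ℝ)) :=
  {p | p.2.1 ∈ SOL (E *ᵥ p.1 + c) F ∧ HasDirDeriv (contactForce E F c) p.1 d p.2.2}

/-- The right-hand side `A x + B u + D l` of the state equation. -/
def stateRHS {n k m : ℕ} (A : Matrix (Fin n) (Fin n) ℝ) (B : Matrix (Fin n) (Fin k) ℝ)
    (D : Matrix (Fin n) (Fin m) ℝ) (x : Fin n → ℝ) (u : Fin k → ℝ) (l : Fin m → ℝ) :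
    Fin n → ℝ :=
  A *ᵥ x + B *ᵥ u + D *ᵥ l

/-- The feedback `u(x, l) = K x + L l`. -/
def feedback {n k m : ℕ} (K : Matrix (Fin k) (Fin n) ℝ) (L : Matrix (Fin k) (Fin m) ℝ)
    (x : Fin n → ℝ) (l : Fin m → ℝ) : Fin k → ℝ :=
  K *ᵥ x + L *ᵥ l

/-- The velocity `A x + B u(x, l) + D l` of the closed loop under `u(x, l) = K x + L l`. -/
def closedLoop {n k m : ℕ} (A : Matrix (Fin n) (Fin n) ℝ) (B : Matrix (Fin n) (Fin k) ℝ)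
    (D : Matrix (Fin n) (Fin m) ℝ) (K : Matrix (Fin k) (Fin n) ℝ)
    (L : Matrix (Fin k) (Fin m) ℝ) (x : Fin n → ℝ) (l : Fin m → ℝ) : Fin n → ℝ :=
  stateRHS A B D x (feedback K L x l) l

/-- `(x, l)` is a trajectory on `[0, ∞)` of the system `x' = v(x, l)`,
`0 ≤ l ⟂ E x + F l + c ≥ 0`. -/
def IsTrajectory {n m : ℕ} (v : (Fin n → ℝ) → (Fin m → ℝ) → (Fin n → ℝ))
    (E : Matrix (Fin m) (Fin n) ℝ) (F : Matrix (Fin m) (Fin m) ℝ) (c : Fin m → ℝ)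
    (x : ℝ → (Fin n → ℝ)) (l : ℝ → (Fin m → ℝ)) : Prop :=
  ∀ t : ℝ, 0 ≤ t →
    HasDerivWithinAt x (v (x t) (l t)) (Set.Ici 0) t ∧ l t ∈ SOL (E *ᵥ x t + c) F

/-- The origin is an equilibrium that is stable in the sense of Lyapunov. (The choice of the norm
on `ℝⁿ` is immaterial here and below, all norms being equivalent.) -/
def LyapunovStable {n m : ℕ} (v : (Fin n → ℝ) → (Fin m → ℝ) → (Fin n → ℝ))
    (E : Matrix (Fin m) (Fin n) ℝ) (F : Matrix (Fin m) (Fin m) ℝ) (c : Fin m → ℝ) : Prop :=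
  (∃ l ∈ SOL (E *ᵥ (0 : Fin n → ℝ) + c) F, v 0 l = 0) ∧
  ∀ ε : ℝ, 0 < ε → ∃ δ : ℝ, 0 < δ ∧ ∀ (x : ℝ → (Fin n → ℝ)) (l : ℝ → (Fin m → ℝ)),
    IsTrajectory v E F c x l → ‖x 0‖ < δ → ∀ t : ℝ, 0 ≤ t → ‖x t‖ < ε

/-- The origin is (locally) asymptotically stable: Lyapunov stable and locally attractive. -/
def AsymptoticallyStable {n m : ℕ} (v : (Fin n → ℝ) → (Fin m → ℝ) → (Fin n → ℝ))
    (E : Matrix (Fin m) (Fin n) ℝ) (F : Matrix (Fin m) (Fin m) ℝ) (c : Fin m → ℝ) : Prop :=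
  LyapunovStable v E F c ∧
  ∃ δ : ℝ, 0 < δ ∧ ∀ (x : ℝ → (Fin n → ℝ)) (l : ℝ → (Fin m → ℝ)),
    IsTrajectory v E F c x l → ‖x 0‖ < δ → Filter.Tendsto x Filter.atTop (𝓝 0)

/-- `V(x, l) = gᵀ M g` with `g = (x, l)` and `M = [P, Q; Qᵀ, R]`. -/
def V {n m : ℕ} (P : Matrix (Fin n) (Fin n) ℝ) (Q : Matrix (Fin n) (Fin m) ℝ)
    (R : Matrix (Fin m) (Fin m) ℝ) (x : Fin n → ℝ) (l : Fin m → ℝ) : ℝ :=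
  Sum.elim x l ⬝ᵥ (Matrix.fromBlocks P Q Qᵀ R *ᵥ Sum.elim x l)

/-- The matrix `N = [N₁₁, N₁₂, Q; N₁₂ᵀ, N₂₂, R; Qᵀ, R, 0]`. -/
def N {n k m : ℕ} (A : Matrix (Fin n) (Fin n) ℝ) (B : Matrix (Fin n) (Fin k) ℝ)
    (D : Matrix (Fin n) (Fin m) ℝ) (K : Matrix (Fin k) (Fin n) ℝ)
    (L : Matrix (Fin k) (Fin m) ℝ) (P : Matrix (Fin n) (Fin n) ℝ)
    (Q : Matrix (Fin n) (Fin m) ℝ) (R : Matrix (Fin m) (Fin m) ℝ) :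
    Matrix ((Fin n ⊕ Fin m) ⊕ Fin m) ((Fin n ⊕ Fin m) ⊕ Fin m) ℝ :=
  let N₁₁ : Matrix (Fin n) (Fin n) ℝ := Aᵀ * P + P * A + Kᵀ * Bᵀ * P + P * B * K
  let N₁₂ : Matrix (Fin n) (Fin m) ℝ := P * B * L + P * D + Aᵀ * Q + Kᵀ * Bᵀ * Q
  let N₂₂ : Matrix (Fin m) (Fin m) ℝ := Lᵀ * Bᵀ * Q + Dᵀ * Q + Qᵀ * D + Qᵀ * B * L
  Matrix.fromBlocks (Matrix.fromBlocks N₁₁ N₁₂ N₁₂ᵀ N₂₂) (Matrix.fromRows Q R)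
    (Matrix.fromCols Qᵀ R) 0

/-- `zᵀ N z` with `z = (x, l, l')`. -/
def Vdot {n k m : ℕ} (A : Matrix (Fin n) (Fin n) ℝ) (B : Matrix (Fin n) (Fin k) ℝ)
    (D : Matrix (Fin n) (Fin m) ℝ) (K : Matrix (Fin k) (Fin n) ℝ)
    (L : Matrix (Fin k) (Fin m) ℝ) (P : Matrix (Fin n) (Fin n) ℝ)
    (Q : Matrix (Fin n) (Fin m) ℝ) (R : Matrix (Fin m) (Fin m) ℝ)
    (x : Fin n → ℝ) (l l' : Fin m → ℝ) : ℝ :=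
  Sum.elim (Sum.elim x l) l' ⬝ᵥ (N A B D K L P Q R *ᵥ Sum.elim (Sum.elim x l) l')

end LCS

/-!
A P-matrix `F` reverses the sign of no nonzero vector: if `z i * (F z) i ≤ 0` for all `i`, then `z`
is in the kernel of some `diag(a) F + diag(b)` with nonnegative weights, whose determinant is a
positive combination of principal minors (`IsPMatrix.eq_zero_of_mul_mulVec_nonpos`). Compactness
gives a modulus `κ > 0` with `κ ‖z‖² ≤ max i, z i * (F z) i` (`IsPMatrix.exists_modulus`). Since the
difference of two solutions of complementarity problems is almost sign-reversed, this yields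
uniqueness and Lipschitz dependence on the data. Existence (`IsPMatrix.exists_solution_on`) goes by
induction on the set of coordinates allowed to be nonzero, with the intermediate value theorem
in the coordinate that is added. The same sign argument shows that the difference quotients of `λ` along a ray are
constant for small times (`exists_contactForce_ray`), so `λ` has directional derivatives.

As `λ` is Lipschitz, its directional derivative computes the right derivative of `λ` along any curve
with a given velocity, and `zᵀ N z` is the right derivative of `V` along trajectories
(`V_hasDerivWithinAt`). Stability is then Lyapunov's classical argument
(`stable_of_derivative_nonpos`). For attractivity `zᵀ N z` is not continuous in `x`, so no uniform
decay rate is available on compact sets. Instead, along an ultrafilter of times, the shifted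
trajectories converge to a curve on which `V` is constant, and whose initial velocity is the value
of the vector field at its initial point; negativity of `zᵀ N z` forces that point to be the origin
(`tendsto_zero_of_derivative_neg`).
-/

namespace LCS

open Filter Set

variable {n k m : ℕ}

/-! ### Sign properties of P-matrices -/

/-- Expanding by multilinearity in the rows, the determinant of `diag(a) F + diag(b)` is a
combination of the principal minors of `F` with coefficients `∏ i ∈ s, a i * ∏ i ∉ s, b i`. -/
theorem IsPMatrix.det_diagonal_mul_add_diagonal_pos {F : Matrix (Fin m) (Fin m) ℝ}
    (hF : IsPMatrix F) {a b : Fin m → ℝ} (ha : 0 ≤ a) (hb : 0 ≤ b) (hab : ∀ i, 0 < a i + b i) :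
    0 < (Matrix.diagonal a * F + Matrix.diagonal b).det := by
  classical
  let f : Fin m → Fin m → ℝ := fun i j => a i * F i j
  let g : Fin m → Fin m → ℝ := fun i j => if i = j then b i else 0
  have key : ∀ s : Finset (Fin m), (Matrix.of (s.piecewise f g)).det =
      (∏ i, s.piecewise a b i) *
        (F.submatrix (fun i : {j // j ∈ s} => (i : Fin m))
          (fun i : {j // j ∈ s} => (i : Fin m))).det := by
    intro s
    let G : Matrix (Fin m) (Fin m) ℝ :=
      Matrix.of fun i j => if i ∈ s then F i j else if i = j then 1 else 0
    have h1 : Matrix.of (s.piecewise f g) = Matrix.of fun i j => s.piecewise a b i * G i j := by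
      ext i j
      by_cases hi : i ∈ s <;> simp [hi, G, f, g]
    rw [h1, Matrix.det_mul_column]
    congr 1
    rw [Matrix.twoBlockTriangular_det G (fun i => i ∈ s)]
    · have h2 : G.toSquareBlockProp (fun i => ¬ i ∈ s) = 1 := by
        ext ⟨i, hi⟩ ⟨j, hj⟩
        simp [Matrix.toSquareBlockProp, G, hi, Matrix.one_apply]
      have h3 : G.toSquareBlockProp (fun i => i ∈ s) =
          F.submatrix (fun i : {j // j ∈ s} => (i : Fin m))
            (fun i : {j // j ∈ s} => (i : Fin m)) := by
        ext ⟨i, hi⟩ ⟨j, hj⟩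
        simp [Matrix.toSquareBlockProp, G, hi]
      rw [h2, h3, Matrix.det_one, mul_one]
      -- The two sides differ in the `Fintype` instance of the index type.
      congr!
    · intro i hi j hj
      have : i ≠ j := fun h => hi (h ▸ hj)
      simp [G, hi, this]
  have hfg : Matrix.diagonal a * F + Matrix.diagonal b = Matrix.of (f + g) := by
    ext i j
    simp [f, g, Matrix.diagonal_apply, Matrix.diagonal_mul]
  rw [hfg]
  have expand : (Matrix.of (f + g)).det =
      ∑ s : Finset (Fin m), (Matrix.of (s.piecewise f g)).det :=
    (Matrix.detRowAlternating (n := Fin m) (R := ℝ)).toMultilinearMap.map_add_univ f g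
  rw [expand]
  have hnonneg : ∀ s : Finset (Fin m), ∀ i, 0 ≤ s.piecewise a b i := by
    intro s i
    by_cases hi : i ∈ s
    · simpa [hi] using ha i
    · simpa [hi] using hb i
  refine Finset.sum_pos' (fun s _ => ?_)
    ⟨Finset.univ.filter (fun i => 0 < a i), Finset.mem_univ _, ?_⟩
  · exact (key s).symm ▸ mul_nonneg (Finset.prod_nonneg fun i _ => hnonneg s i) (hF s).le
  · refine (key _).symm ▸ mul_pos (Finset.prod_pos fun i _ => ?_) (hF _)
    by_cases hi : 0 < a i
    · simp [Finset.piecewise, hi]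
    · have := hab i
      have h0 : a i = 0 := le_antisymm (not_lt.1 hi) (ha i)
      rw [h0, zero_add] at this
      simpa [Finset.piecewise, hi] using this

/-- A P-matrix reverses the sign of no nonzero vector. -/
theorem IsPMatrix.eq_zero_of_mul_mulVec_nonpos {F : Matrix (Fin m) (Fin m) ℝ} (hF : IsPMatrix F)
    {z : Fin m → ℝ} (hz : ∀ i, z i * (F *ᵥ z) i ≤ 0) : z = 0 := by
  classical
  by_contra hne
  -- With these nonnegative weights `z` lies in the kernel of `diag(a) F + diag(b)`; the summand
  -- `if z i = 0 then 1 else 0` makes the weights admissible where `z` vanishes.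
  let a : Fin m → ℝ := fun i => z i ^ 2
  let b : Fin m → ℝ := fun i => -(z i * (F *ᵥ z) i) + if z i = 0 then 1 else 0
  have ha : 0 ≤ a := fun i => sq_nonneg _
  have hb : 0 ≤ b := by
    intro i
    have := hz i
    simp only [b, Pi.zero_apply]
    split_ifs <;> linarith
  have hab : ∀ i, 0 < a i + b i := by
    intro i
    by_cases hi : z i = 0
    · simp [a, b, hi]
    · have h1 : 0 < z i ^ 2 := by positivity
      have := hb i
      exact add_pos_of_pos_of_nonneg h1 this
  have hdet := hF.det_diagonal_mul_add_diagonal_pos ha hb hab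
  refine hdet.ne' (Matrix.exists_mulVec_eq_zero_iff.1 ⟨z, hne, ?_⟩)
  ext i
  rw [Matrix.add_mulVec, ← Matrix.mulVec_mulVec, Pi.add_apply, Matrix.mulVec_diagonal,
    Matrix.mulVec_diagonal]
  by_cases hi : z i = 0
  · simp [a, b, hi]
  · simp only [a, b, hi, if_false, Pi.zero_apply]
    ring

/-- Quantitative form of the sign property, by compactness of the unit sphere. -/
theorem IsPMatrix.exists_modulus {F : Matrix (Fin m) (Fin m) ℝ} (hF : IsPMatrix F) :
    ∃ κ : ℝ, 0 < κ ∧ ∀ z : Fin m → ℝ, z ≠ 0 → ∃ i, κ * ‖z‖ ^ 2 ≤ z i * (F *ᵥ z) i := by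
  rcases isEmpty_or_nonempty (Fin m) with hm | hm
  · exact ⟨1, one_pos, fun z hz => (hz (Subsingleton.elim _ _)).elim⟩
  let φ : (Fin m → ℝ) → ℝ := fun z => Finset.univ.sup' Finset.univ_nonempty
    fun i => z i * (F *ᵥ z) i
  have hφ : Continuous φ := Continuous.finset_sup'_apply _ fun i _ => by fun_prop
  have hmax : ∀ z, ∃ i, φ z = z i * (F *ᵥ z) i := fun z => by
    obtain ⟨i, -, hi⟩ := Finset.exists_mem_eq_sup' Finset.univ_nonempty
      (fun i => z i * (F *ᵥ z) i)
    exact ⟨i, hi⟩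
  have hpos : ∀ z, z ≠ 0 → 0 < φ z := by
    intro z hz
    by_contra h
    refine hz (hF.eq_zero_of_mul_mulVec_nonpos fun i => ?_)
    exact (Finset.le_sup' (fun i => z i * (F *ᵥ z) i) (Finset.mem_univ i)).trans (not_lt.1 h)
  have hsph : (Metric.sphere (0 : Fin m → ℝ) 1).Nonempty :=
    NormedSpace.sphere_nonempty.2 zero_le_one
  obtain ⟨z₀, hz₀, hmin⟩ := (isCompact_sphere (0 : Fin m → ℝ) 1).exists_isMinOn hsph
    hφ.continuousOn
  have hz₀' : z₀ ≠ 0 := by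
    rintro rfl
    simp at hz₀
  refine ⟨φ z₀, hpos z₀ hz₀', fun z hz => ?_⟩
  have hn : 0 < ‖z‖ := norm_pos_iff.2 hz
  obtain ⟨i, hi⟩ := hmax (‖z‖⁻¹ • z)
  refine ⟨i, ?_⟩
  have h1 : φ z₀ ≤ φ (‖z‖⁻¹ • z) := hmin (by simp [norm_smul, hn.ne'])
  rw [hi, Matrix.mulVec_smul, Pi.smul_apply, Pi.smul_apply, smul_eq_mul, smul_eq_mul] at h1
  calc φ z₀ * ‖z‖ ^ 2 ≤ (‖z‖⁻¹ * z i * (‖z‖⁻¹ * (F *ᵥ z) i)) * ‖z‖ ^ 2 := by gcongr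
    _ = z i * (F *ᵥ z) i := by field_simp

/-! ### Existence, uniqueness and Lipschitz dependence for the complementarity problem -/

theorem exists_norm_mulVec_le {p q : ℕ} (A : Matrix (Fin p) (Fin q) ℝ) :
    ∃ C : ℝ≥0, ∀ x, ‖A *ᵥ x‖ ≤ C * ‖x‖ :=
  ⟨‖(Matrix.toLin' A).toContinuousLinearMap‖₊,
    fun x => (Matrix.toLin' A).toContinuousLinearMap.le_opNorm x⟩

theorem mem_SOL_iff {w l : Fin m → ℝ} {F : Matrix (Fin m) (Fin m) ℝ} :
    l ∈ SOL w F ↔ ∀ i, 0 ≤ l i ∧ 0 ≤ (F *ᵥ l + w) i ∧ l i * (F *ᵥ l + w) i = 0 := by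
  constructor
  · rintro ⟨h1, h2, h3⟩ i
    refine ⟨h1 i, h2 i, ?_⟩
    exact (Finset.sum_eq_zero_iff_of_nonneg fun j _ => mul_nonneg (h1 j) (h2 j)).1 h3 i
      (Finset.mem_univ i)
  · intro h
    exact ⟨fun i => (h i).1, fun i => (h i).2.1, Finset.sum_eq_zero fun i _ => (h i).2.2⟩

/-- Complementary pairs are monotonically related. -/
theorem sub_mul_sub_nonpos {a b a' b' : ℝ} (ha : 0 ≤ a) (hb : 0 ≤ b) (h : a * b = 0)
    (ha' : 0 ≤ a') (hb' : 0 ≤ b') (h' : a' * b' = 0) : (a - a') * (b - b') ≤ 0 := by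
  nlinarith [mul_nonneg ha hb', mul_nonneg ha' hb]

/-- Solvability of the problem restricted to the indices in `S`, by induction on `S`. The new
coordinate `s` is a parameter: the remaining coordinates depend continuously on it, and the
residual in the new coordinate grows at least linearly, so that the intermediate value theorem
applies. -/
theorem IsPMatrix.exists_solution_on {F : Matrix (Fin m) (Fin m) ℝ} (hF : IsPMatrix F)
    (S : Finset (Fin m)) : ∀ w : Fin m → ℝ, ∃ l : Fin m → ℝ, (∀ i ∉ S, l i = 0) ∧
      ∀ i ∈ S, 0 ≤ l i ∧ 0 ≤ (F *ᵥ l + w) i ∧ l i * (F *ᵥ l + w) i = 0 := by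
  classical
  obtain ⟨κ, hκ, hmod⟩ := hF.exists_modulus
  obtain ⟨C, hC⟩ := exists_norm_mulVec_le F
  induction S using Finset.induction_on with
  | empty => exact fun w => ⟨0, by simp, by simp⟩
  | insert a S haS ih =>
    intro w
    choose y hy0 hy using fun s : ℝ => ih (w + F *ᵥ Pi.single a s)
    let l : ℝ → Fin m → ℝ := fun s => y s + Pi.single a s
    have hla : ∀ s, l s a = s := fun s => by simp [l, hy0 s a haS]
    have hlne : ∀ s i, i ≠ a → l s i = y s i := fun s i hi => by simp [l, hi]
    have hres : ∀ s, F *ᵥ l s + w = F *ᵥ y s + (w + F *ᵥ Pi.single a s) := fun s => by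
      simp only [l, Matrix.mulVec_add]
      abel
    have hS : ∀ s, ∀ i ∈ S,
        0 ≤ l s i ∧ 0 ≤ (F *ᵥ l s + w) i ∧ l s i * (F *ᵥ l s + w) i = 0 := by
      intro s i hi
      rw [hres, hlne s i (fun h => haS (h ▸ hi))]
      exact hy s i hi
    have hl0 : ∀ s, ∀ i ∉ insert a S, l s i = 0 := by
      intro s i hi
      rw [Finset.mem_insert, not_or] at hi
      rw [hlne s i hi.1, hy0 s i hi.2]
    have hdiff : ∀ s t i, (F *ᵥ (l s - l t)) i = (F *ᵥ l s + w) i - (F *ᵥ l t + w) i :=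
      fun s t i => by simp [Matrix.mulVec_sub]
    have hkey : ∀ s t, κ * ‖l s - l t‖ ^ 2 ≤ (s - t) * (F *ᵥ (l s - l t)) a := by
      intro s t
      by_cases hz : l s - l t = 0
      · simp [hz]
      obtain ⟨i, hi⟩ := hmod _ hz
      have hp : 0 < κ * ‖l s - l t‖ ^ 2 := by
        have := norm_pos_iff.2 hz
        positivity
      by_cases hia : i = a
      · subst hia
        simpa [hla] using hi
      · exfalso
        refine absurd (hp.trans_le hi) (not_lt.2 ?_)
        by_cases hiS : i ∈ S
        · obtain ⟨h1, h2, h3⟩ := hS s i hiS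
          obtain ⟨h1', h2', h3'⟩ := hS t i hiS
          rw [hdiff, Pi.sub_apply]
          exact sub_mul_sub_nonpos h1 h2 h3 h1' h2' h3'
        · have : i ∉ insert a S := by simp [hia, hiS]
          simp [hl0 s i this, hl0 t i this]
    have hlip : ∀ s t, ‖l s - l t‖ ≤ C / κ * ‖s - t‖ := by
      intro s t
      rcases (norm_nonneg (l s - l t)).eq_or_lt with h0 | h0
      · rw [← h0]
        positivity
      have h1 : (s - t) * (F *ᵥ (l s - l t)) a ≤ ‖s - t‖ * (C * ‖l s - l t‖) :=
        calc (s - t) * (F *ᵥ (l s - l t)) a ≤ ‖(s - t) * (F *ᵥ (l s - l t)) a‖ := le_abs_self _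
          _ = ‖s - t‖ * ‖(F *ᵥ (l s - l t)) a‖ := norm_mul _ _
          _ ≤ ‖s - t‖ * (C * ‖l s - l t‖) := by
            gcongr
            exact (norm_le_pi_norm _ a).trans (hC _)
      have h2 := (hkey s t).trans h1
      rw [div_mul_eq_mul_div, le_div_iff₀ hκ]
      nlinarith
    have hcont : Continuous l := by
      refine (LipschitzWith.of_dist_le_mul (K := ⟨C / κ, by positivity⟩) fun s t => ?_).continuous
      rw [dist_eq_norm, dist_eq_norm]
      exact hlip s t
    let h : ℝ → ℝ := fun s => (F *ᵥ l s + w) a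
    have hh : Continuous h := by fun_prop
    suffices hs : ∃ s, 0 ≤ s ∧ 0 ≤ h s ∧ s * h s = 0 by
      obtain ⟨s, h1, h2, h3⟩ := hs
      refine ⟨l s, hl0 s, fun i hi => ?_⟩
      rcases Finset.mem_insert.1 hi with rfl | hi
      · rw [hla]
        exact ⟨h1, h2, h3⟩
      · exact hS s i hi
    by_cases h0 : 0 ≤ h 0
    · exact ⟨0, le_rfl, h0, zero_mul _⟩
    have hgrow : ∀ s, 0 < s → h 0 + κ * s ≤ h s := by
      intro s hs
      have h1 := hkey s 0
      have h2 : s ≤ ‖l s - l 0‖ := by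
        have := norm_le_pi_norm (l s - l 0) a
        rw [Pi.sub_apply, hla, hla, sub_zero] at this
        exact (le_abs_self s).trans this
      have h3 : (F *ᵥ (l s - l 0)) a = h s - h 0 := hdiff s 0 a
      rw [h3, sub_zero] at h1
      have h4 : κ * s ^ 2 ≤ s * (h s - h 0) := le_trans (by gcongr) h1
      have h5 : κ * s ≤ h s - h 0 := le_of_mul_le_mul_left (by linarith) hs
      linarith
    have hneg : h 0 < 0 := not_le.1 h0
    -- At `s = -h 0 / κ` the linear lower bound for `h` vanishes.
    have hs₁ : 0 < -h 0 / κ := div_pos (neg_pos.2 hneg) hκ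
    have hpos : 0 ≤ h (-h 0 / κ) := by
      have := hgrow _ hs₁
      rwa [mul_div_cancel₀ _ hκ.ne', add_neg_cancel] at this
    obtain ⟨s, hs, hs0⟩ := intermediate_value_Icc hs₁.le hh.continuousOn ⟨hneg.le, hpos⟩
    exact ⟨s, hs.1, hs0.ge, by rw [hs0, mul_zero]⟩

/-- Lipschitz dependence of solutions on the data. -/
theorem IsPMatrix.exists_norm_sub_le {F : Matrix (Fin m) (Fin m) ℝ} (hF : IsPMatrix F) :
    ∃ C : ℝ≥0, ∀ {w w' l l' : Fin m → ℝ}, l ∈ SOL w F → l' ∈ SOL w' F →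
      ‖l - l'‖ ≤ C * ‖w - w'‖ := by
  obtain ⟨κ, hκ, hmod⟩ := hF.exists_modulus
  refine ⟨⟨κ⁻¹, by positivity⟩, fun {w w' l l'} hl hl' => ?_⟩
  change _ ≤ κ⁻¹ * _
  by_cases hz : l - l' = 0
  · rw [hz, norm_zero]
    positivity
  have hp := norm_pos_iff.2 hz
  obtain ⟨i, hi⟩ := hmod _ hz
  obtain ⟨h1, h2, h3⟩ := mem_SOL_iff.1 hl i
  obtain ⟨h1', h2', h3'⟩ := mem_SOL_iff.1 hl' i
  have h4 := sub_mul_sub_nonpos h1 h2 h3 h1' h2' h3'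
  have h5 : κ * ‖l - l'‖ ^ 2 ≤ ‖l - l'‖ * ‖w - w'‖ := by
    have h6 : (F *ᵥ (l - l')) i = (F *ᵥ l + w) i - (F *ᵥ l' + w') i - (w - w') i := by
      simp [Matrix.mulVec_sub]
      ring
    have h7 : -((l - l') i * (w - w') i) ≤ ‖l - l'‖ * ‖w - w'‖ :=
      calc -((l - l') i * (w - w') i) ≤ ‖(l - l') i * (w - w') i‖ := neg_le_abs _
        _ = ‖(l - l') i‖ * ‖(w - w') i‖ := norm_mul _ _
        _ ≤ _ := by gcongr <;> exact norm_le_pi_norm _ i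
    rw [h6] at hi
    have h8 : (l - l') i = l i - l' i := rfl
    nlinarith
  rw [inv_mul_eq_div, le_div_iff₀ hκ]
  nlinarith

theorem IsPMatrix.existsUnique_mem_SOL {F : Matrix (Fin m) (Fin m) ℝ} (hF : IsPMatrix F)
    (w : Fin m → ℝ) : ∃! l, l ∈ SOL w F := by
  obtain ⟨l, -, hl⟩ := hF.exists_solution_on Finset.univ w
  obtain ⟨C, hC⟩ := hF.exists_norm_sub_le
  have hmem : l ∈ SOL w F := mem_SOL_iff.2 fun i => hl i (Finset.mem_univ i)
  refine ⟨l, hmem, fun l' hl' => ?_⟩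
  have := hC hl' hmem
  rwa [sub_self, norm_zero, mul_zero, norm_le_zero_iff, sub_eq_zero] at this

/-! ### The contact force as a function of the state -/

section ContactForce

variable {E : Matrix (Fin m) (Fin n) ℝ} {F : Matrix (Fin m) (Fin m) ℝ} {c : Fin m → ℝ}

theorem contactForce_mem (hF : IsPMatrix F) (x : Fin n → ℝ) :
    contactForce E F c x ∈ SOL (E *ᵥ x + c) F :=
  Classical.epsilon_spec (hF.existsUnique_mem_SOL (E *ᵥ x + c)).exists

theorem eq_contactForce (hF : IsPMatrix F) {x : Fin n → ℝ} {l : Fin m → ℝ}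
    (hl : l ∈ SOL (E *ᵥ x + c) F) : l = contactForce E F c x :=
  (hF.existsUnique_mem_SOL (E *ᵥ x + c)).unique hl (contactForce_mem hF x)

theorem contactForce_zero (hF : IsPMatrix F) (hc : 0 ≤ c) : contactForce E F c 0 = 0 :=
  (eq_contactForce hF ⟨le_rfl, by simpa using hc, by simp⟩).symm

theorem exists_lipschitzWith_contactForce (hF : IsPMatrix F) :
    ∃ C : ℝ≥0, LipschitzWith C (contactForce E F c) := by
  obtain ⟨C, hC⟩ := hF.exists_norm_sub_le
  obtain ⟨C', hC'⟩ := exists_norm_mulVec_le E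
  refine ⟨C * C', LipschitzWith.of_dist_le_mul fun x y => ?_⟩
  rw [dist_eq_norm, dist_eq_norm]
  refine (hC (contactForce_mem hF x) (contactForce_mem hF y)).trans ?_
  rw [add_sub_add_right_eq_sub, ← Matrix.mulVec_sub, NNReal.coe_mul, mul_assoc]
  gcongr
  exact hC' _

/-- Along a ray the contact force is affine near the starting point: for small `t > 0` the
indices with `λ(x) i > 0`, respectively `(E x + F λ(x) + c) i > 0`, keep this strict inequality, so
that any two difference quotients `v`, `v'` satisfy `(v - v') i * (F (v - v')) i ≤ 0`. -/
theorem exists_contactForce_ray (hF : IsPMatrix F) (x d : Fin n → ℝ) :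
    ∃ v : Fin m → ℝ, ∀ᶠ t in 𝓝[>] (0 : ℝ),
      contactForce E F c (x + t • d) = contactForce E F c x + t • v := by
  obtain ⟨C, hC⟩ := exists_lipschitzWith_contactForce (E := E) (c := c) hF
  let l : ℝ → Fin m → ℝ := fun t => contactForce E F c (x + t • d)
  let r : ℝ → Fin m → ℝ := fun t => F *ᵥ l t + (E *ᵥ (x + t • d) + c)
  have hlc : Continuous l := hC.continuous.comp (by fun_prop)
  have hrc : Continuous r := by fun_prop
  have hsol : ∀ t i, 0 ≤ l t i ∧ 0 ≤ r t i ∧ l t i * r t i = 0 := fun t =>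
    mem_SOL_iff.1 (contactForce_mem hF _)
  have hev : ∀ᶠ t in 𝓝 (0 : ℝ), ∀ i, (0 < l 0 i → 0 < l t i) ∧ (0 < r 0 i → 0 < r t i) := by
    refine eventually_all.2 fun i => Filter.Eventually.and ?_ ?_
    · by_cases h : 0 < l 0 i
      · exact (((continuous_apply i).comp hlc).continuousAt.eventually (lt_mem_nhds h)).mono
          fun t ht _ => ht
      · exact Eventually.of_forall fun t h' => (h h').elim
    · by_cases h : 0 < r 0 i
      · exact (((continuous_apply i).comp hrc).continuousAt.eventually (lt_mem_nhds h)).mono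
          fun t ht _ => ht
      · exact Eventually.of_forall fun t h' => (h h').elim
  have hev' := (hev.filter_mono nhdsWithin_le_nhds).and
    (self_mem_nhdsWithin : Ioi (0 : ℝ) ∈ 𝓝[>] (0 : ℝ))
  have hl0 : l 0 = contactForce E F c x := by simp [l]
  obtain ⟨t₀, ht₀, ht₀pos⟩ := hev'.exists
  let v : ℝ → Fin m → ℝ := fun t => t⁻¹ • (l t - l 0)
  have hv : ∀ t : ℝ, 0 < t → l t = l 0 + t • v t := fun t ht => by
    simp [v, smul_smul, ht.ne']
  have hr : ∀ t : ℝ, 0 < t → ∀ i, r t i = r 0 i + t * ((F *ᵥ v t) i + (E *ᵥ d) i) := by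
    intro t ht i
    simp only [r]
    rw [hv t ht]
    simp [Matrix.mulVec_add, Matrix.mulVec_smul]
    ring
  refine ⟨v t₀, hev'.mono fun t ⟨ht, htpos⟩ => ?_⟩
  have htpos : 0 < t := htpos
  have ht₀pos : 0 < t₀ := ht₀pos
  have heq : v t - v t₀ = 0 := by
    refine hF.eq_zero_of_mul_mulVec_nonpos fun i => ?_
    rw [Matrix.mulVec_sub, Pi.sub_apply, Pi.sub_apply]
    have hlt : l t i = l 0 i + t * v t i := congrFun (hv t htpos) i
    have hlt₀ : l t₀ i = l 0 i + t₀ * v t₀ i := congrFun (hv t₀ ht₀pos) i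
    have hrt := hr t htpos i
    have hrt₀ := hr t₀ ht₀pos i
    obtain ⟨a1, a2, a3⟩ := hsol 0 i
    obtain ⟨b1, b2, b3⟩ := hsol t i
    obtain ⟨c1, c2, c3⟩ := hsol t₀ i
    rcases a1.eq_or_lt with h | h
    · rcases a2.eq_or_lt with h' | h'
      · rw [← h, zero_add] at hlt hlt₀
        rw [← h', zero_add] at hrt hrt₀
        rw [hlt, hrt] at b3
        rw [hlt₀, hrt₀] at c3
        rw [hlt] at b1
        rw [hrt] at b2
        rw [hlt₀] at c1
        rw [hrt₀] at c2
        rw [mul_mul_mul_comm] at b3 c3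
        have := sub_mul_sub_nonpos
          (nonneg_of_mul_nonneg_right b1 htpos) (nonneg_of_mul_nonneg_right b2 htpos)
          ((mul_eq_zero.1 b3).resolve_left (by positivity))
          (nonneg_of_mul_nonneg_right c1 ht₀pos) (nonneg_of_mul_nonneg_right c2 ht₀pos)
          ((mul_eq_zero.1 c3).resolve_left (by positivity))
        simpa using this
      · have e1 : l t i = 0 := (mul_eq_zero.1 b3).resolve_right ((ht i).2 h').ne'
        have e2 : l t₀ i = 0 := (mul_eq_zero.1 c3).resolve_right ((ht₀ i).2 h').ne'
        have e3 : v t i = 0 := by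
          rw [hlt, ← h, zero_add] at e1
          exact (mul_eq_zero.1 e1).resolve_left htpos.ne'
        have e4 : v t₀ i = 0 := by
          rw [hlt₀, ← h, zero_add] at e2
          exact (mul_eq_zero.1 e2).resolve_left ht₀pos.ne'
        simp [e3, e4]
    · have e0 : r 0 i = 0 := (mul_eq_zero.1 a3).resolve_left h.ne'
      have e1 : r t i = 0 := (mul_eq_zero.1 b3).resolve_left ((ht i).1 h).ne'
      have e2 : r t₀ i = 0 := (mul_eq_zero.1 c3).resolve_left ((ht₀ i).1 h).ne'
      have e3 : (F *ᵥ v t) i + (E *ᵥ d) i = 0 := by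
        rw [hrt, e0, zero_add] at e1
        exact (mul_eq_zero.1 e1).resolve_left htpos.ne'
      have e4 : (F *ᵥ v t₀) i + (E *ᵥ d) i = 0 := by
        rw [hrt₀, e0, zero_add] at e2
        exact (mul_eq_zero.1 e2).resolve_left ht₀pos.ne'
      have : (F *ᵥ v t) i - (F *ᵥ v t₀) i = 0 := by linarith
      rw [this, mul_zero]
  rw [← hl0, ← sub_eq_zero.1 heq]
  exact hv t htpos

theorem exists_hasDirDeriv_contactForce (hF : IsPMatrix F) (x d : Fin n → ℝ) :
    ∃ v : Fin m → ℝ, HasDirDeriv (contactForce E F c) x d v := by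
  obtain ⟨v, hv⟩ := exists_contactForce_ray (E := E) (c := c) hF x d
  refine ⟨v, tendsto_const_nhds.congr' ?_⟩
  filter_upwards [hv, self_mem_nhdsWithin] with t ht htpos
  have htpos : 0 < t := htpos
  rw [ht, add_sub_cancel_left, smul_smul, inv_mul_cancel₀ htpos.ne', one_smul]

end ContactForce

/-! ### Lyapunov's method with one-sided derivatives -/

section Lyapunov

variable {X : Type*} [NormedAddCommGroup X] [NormedSpace ℝ X] {f : X → X} {g g' : X → ℝ}
  {𝒟 : Set X} {x : ℝ → X}

theorem hasDerivWithinAt_Ici_self {y : X} {t : ℝ} (ht : 0 ≤ t)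
    (h : HasDerivWithinAt x y (Ici 0) t) : HasDerivWithinAt x y (Ici t) t :=
  h.mono (Ici_subset_Ici.2 ht)

/-- A function whose right derivative along solutions is nonpositive on `𝒟` does not increase along
a solution while the latter stays in `𝒟`. -/
theorem comp_le_comp_of_derivative_nonpos (hg : Continuous g)
    (hgf : ∀ (q : ℝ → X) (t : ℝ), HasDerivWithinAt q (f (q t)) (Ici t) t →
      HasDerivWithinAt (fun s => g (q s)) (g' (q t)) (Ici t) t)
    (hg' : ∀ y ∈ 𝒟, g' y ≤ 0)
    (hx : ∀ t, 0 ≤ t → HasDerivWithinAt x (f (x t)) (Ici 0) t)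
    {a b : ℝ} (ha : 0 ≤ a) (hab : a ≤ b) (h𝒟 : ∀ t ∈ Ico a b, x t ∈ 𝒟) : g (x b) ≤ g (x a) := by
  have hc : ContinuousOn x (Icc a b) := fun t ht =>
    (hx t (ha.trans ht.1)).continuousWithinAt.mono fun s hs => ha.trans hs.1
  exact image_le_of_deriv_right_le_deriv_boundary (B := fun _ => g (x a)) (B' := fun _ => 0)
    (hg.comp_continuousOn hc)
    (fun t ht => hgf x t (hasDerivWithinAt_Ici_self (ha.trans ht.1) (hx t (ha.trans ht.1))))
    le_rfl continuousOn_const (fun t _ => hasDerivWithinAt_const _ _ _)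
    (fun t ht => hg' _ (h𝒟 t ht)) (right_mem_Icc.2 hab)

/-- Lyapunov's stability theorem: a solution starting near the origin cannot reach a small sphere,
on which `g` is bounded below by a positive constant. -/
theorem stable_of_derivative_nonpos [ProperSpace X] (hg : Continuous g) (hg0 : g 0 = 0)
    (h𝒟 : 𝒟 ∈ 𝓝 0) (hpos : ∀ y ∈ 𝒟, y ≠ 0 → 0 < g y)
    (hgf : ∀ (q : ℝ → X) (t : ℝ), HasDerivWithinAt q (f (q t)) (Ici t) t →
      HasDerivWithinAt (fun s => g (q s)) (g' (q t)) (Ici t) t)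
    (hg' : ∀ y ∈ 𝒟, g' y ≤ 0) {ε : ℝ} (hε : 0 < ε) :
    ∃ δ : ℝ, 0 < δ ∧ ∀ x : ℝ → X, (∀ t, 0 ≤ t → HasDerivWithinAt x (f (x t)) (Ici 0) t) →
      ‖x 0‖ < δ → ∀ t, 0 ≤ t → ‖x t‖ < ε := by
  obtain ⟨ρ, hρ, hball⟩ := Metric.nhds_basis_closedBall.mem_iff.1 h𝒟
  obtain ⟨r, hr0, hrε, hr𝒟⟩ : ∃ r, 0 < r ∧ r ≤ ε ∧ Metric.closedBall (0 : X) r ⊆ 𝒟 :=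
    ⟨min ρ ε, lt_min hρ hε, min_le_right _ _,
      (Metric.closedBall_subset_closedBall (min_le_left _ _)).trans hball⟩
  obtain ⟨μ, hμ0, hμ⟩ : ∃ μ, 0 < μ ∧ ∀ y ∈ Metric.sphere (0 : X) r, μ ≤ g y := by
    rcases (Metric.sphere (0 : X) r).eq_empty_or_nonempty with h | h
    · exact ⟨1, one_pos, fun y hy => by simp [h] at hy⟩
    · obtain ⟨y₀, hy₀, hmin⟩ := (isCompact_sphere (0 : X) r).exists_isMinOn h hg.continuousOn
      refine ⟨g y₀, hpos y₀ (hr𝒟 (Metric.sphere_subset_closedBall hy₀)) ?_, fun y hy => hmin hy⟩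
      rintro rfl
      simp [hr0.ne] at hy₀
  obtain ⟨η, hη, hηg⟩ := Metric.mem_nhds_iff.1
    (hg.continuousAt.eventually (gt_mem_nhds (hg0.symm ▸ hμ0)))
  refine ⟨min η r, lt_min hη hr0, fun x hx hx0 t ht => ?_⟩
  by_contra hcon
  have hc : ContinuousOn x (Icc 0 t) := fun s hs =>
    (hx s hs.1).continuousWithinAt.mono fun u hu => hu.1
  let S : Set ℝ := Icc 0 t ∩ (fun s => ‖x s‖) ⁻¹' Ici r
  have hSc : IsCompact S := isCompact_Icc.of_isClosed_subset
    (hc.norm.preimage_isClosed_of_isClosed isClosed_Icc isClosed_Ici) inter_subset_left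
  obtain ⟨τ, ⟨⟨hτ0, hτt⟩, hτr⟩, hτmin⟩ := hSc.exists_isLeast
    ⟨t, ⟨ht, le_rfl⟩, hrε.trans (not_lt.1 hcon)⟩
  have hbefore : ∀ s ∈ Ico 0 τ, ‖x s‖ < r := fun s hs => by
    by_contra h
    exact absurd (hτmin ⟨⟨hs.1, hs.2.le.trans hτt⟩, not_lt.1 h⟩) (not_le.2 hs.2)
  have hτeq : ‖x τ‖ = r := by
    obtain ⟨s, hs, hsr⟩ := intermediate_value_Icc hτ0
      (hc.norm.mono (Icc_subset_Icc_right hτt)) ⟨(hx0.trans_le (min_le_right _ _)).le, hτr⟩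
    have : τ ≤ s := hτmin ⟨⟨hs.1, hs.2.trans hτt⟩, hsr.ge⟩
    rw [le_antisymm this hs.2]
    exact hsr
  have h1 : g (x τ) ≤ g (x 0) := comp_le_comp_of_derivative_nonpos hg hgf hg' hx le_rfl hτ0
    fun s hs => hr𝒟 (by simpa using (hbefore s hs).le)
  have h2 : g (x 0) < μ := hηg (by simpa using hx0.trans_le (min_le_left _ _))
  have h3 : μ ≤ g (x τ) := hμ _ (by simpa using hτeq)
  linarith

/-- Second-order remainder for a solution that stays in a ball around an equilibrium. -/
theorem norm_sub_sub_smul_le {C : ℝ≥0} (hf : LipschitzWith C f) (hf0 : f 0 = 0) {r : ℝ}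
    (hx : ∀ t, 0 ≤ t → HasDerivWithinAt x (f (x t)) (Ici 0) t)
    (hr : ∀ t, 0 ≤ t → ‖x t‖ ≤ r) {t s : ℝ} (ht : 0 ≤ t) (hs : 0 ≤ s) :
    ‖x (t + s) - x t - s • f (x t)‖ ≤ C * C * r * s ^ 2 := by
  have hr0 : 0 ≤ r := (norm_nonneg _).trans (hr 0 le_rfl)
  have hder : ∀ u, 0 ≤ u → HasDerivWithinAt (fun u => x (t + u)) (f (x (t + u))) (Ici 0) u := by
    intro u hu
    have h1 := (hx (t + u) (by positivity)).scomp u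
      ((hasDerivAt_id u).const_add t).hasDerivWithinAt (s := Ici 0)
      (fun v hv => add_nonneg ht hv)
    simpa [Function.comp_def] using h1
  have hfb : ∀ u, 0 ≤ u → ‖f (x u)‖ ≤ C * r := fun u hu => by
    have h1 := hf.norm_sub_le (x u) 0
    rw [hf0, sub_zero, sub_zero] at h1
    exact h1.trans (by gcongr; exact hr u hu)
  have hspeed : ∀ u, 0 ≤ u → ‖x (t + u) - x t‖ ≤ C * r * u := by
    intro u hu
    have := norm_image_sub_le_of_norm_deriv_right_le_segment (f := fun u => x (t + u))
      (f' := fun u => f (x (t + u))) (a := 0) (b := u) (C := C * r)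
      (fun v hv => (hder v hv.1).continuousWithinAt.mono fun w hw => hw.1)
      (fun v hv => hasDerivWithinAt_Ici_self hv.1 (hder v hv.1))
      (fun v hv => hfb _ (add_nonneg ht hv.1)) u ⟨hu, le_rfl⟩
    simpa using this
  have hder' : ∀ u, 0 ≤ u → HasDerivWithinAt (fun u => x (t + u) - u • f (x t))
      (f (x (t + u)) - f (x t)) (Ici 0) u := fun u hu => by
    simpa using (hder u hu).fun_sub ((hasDerivAt_id u).smul_const (f (x t))).hasDerivWithinAt
  have := norm_image_sub_le_of_norm_deriv_right_le_segment
    (f := fun u => x (t + u) - u • f (x t)) (f' := fun u => f (x (t + u)) - f (x t))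
    (a := 0) (b := s) (C := C * (C * r * s))
    (fun v hv => (hder' v hv.1).continuousWithinAt.mono fun w hw => hw.1)
    (fun v hv => hasDerivWithinAt_Ici_self hv.1 (hder' v hv.1))
    (fun v hv => (hf.norm_sub_le _ _).trans (by
      gcongr
      refine (hspeed v hv.1).trans ?_
      have := hv.2.le
      gcongr)) s ⟨hs, le_rfl⟩
  simp only [add_zero, zero_smul, sub_zero] at this
  rw [sub_right_comm]
  refine this.trans_eq ?_
  ring

/-- An invariance principle. The limits `q s` of `x (t + s)` along an ultrafilter of times
`t → ∞` form a curve with right derivative `f (q 0)` at `0`, on which `g` is constant, so `g'`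
vanishes at `q 0`. No continuity of `g'` is needed. -/
theorem tendsto_zero_of_derivative_neg [ProperSpace X] {C : ℝ≥0} (hf : LipschitzWith C f)
    (hf0 : f 0 = 0) (hg : Continuous g)
    (hgf : ∀ (q : ℝ → X) (t : ℝ), HasDerivWithinAt q (f (q t)) (Ici t) t →
      HasDerivWithinAt (fun s => g (q s)) (g' (q t)) (Ici t) t)
    (hg' : ∀ y ∈ 𝒟, g' y ≤ 0) (hneg : ∀ y ∈ 𝒟, y ≠ 0 → g' y < 0)
    (hx : ∀ t, 0 ≤ t → HasDerivWithinAt x (f (x t)) (Ici 0) t)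
    {r : ℝ} (hr𝒟 : Metric.closedBall 0 r ⊆ 𝒟) (hr : ∀ t, 0 ≤ t → ‖x t‖ ≤ r) :
    Tendsto x atTop (𝓝 0) := by
  have hball : ∀ t, 0 ≤ t → x t ∈ Metric.closedBall (0 : X) r := fun t ht => by
    simpa using hr t ht
  have hK : IsCompact (Metric.closedBall (0 : X) r) := isCompact_closedBall _ _
  obtain ⟨c₀, hc₀⟩ : ∃ c₀, Tendsto (fun t => g (x t)) atTop (𝓝 c₀) := by
    -- Extending the nonincreasing function `g ∘ x` by a constant to negative times.
    have hanti : Antitone fun t => g (x (max t 0)) := fun a b hab =>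
      comp_le_comp_of_derivative_nonpos hg hgf hg' hx (le_max_right _ _)
        (max_le_max_right _ hab) fun t ht => hr𝒟 (hball t ((le_max_right _ _).trans ht.1))
    have hbdd : BddBelow (range fun t => g (x (max t 0))) :=
      (hK.bddBelow_image hg.continuousOn).mono (by
        rintro _ ⟨t, rfl⟩
        exact ⟨_, hball _ (le_max_right _ _), rfl⟩)
    refine ⟨_, (tendsto_atTop_ciInf hanti hbdd).congr' ?_⟩
    filter_upwards [eventually_ge_atTop (0 : ℝ)] with t ht
    rw [max_eq_left ht]
  rw [tendsto_iff_ultrafilter]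
  intro U hU
  have hlim : ∀ s : ℝ, ∃ y ∈ Metric.closedBall (0 : X) r,
      Tendsto (fun t => x (t + s)) U (𝓝 y) := by
    intro s
    refine hK.ultrafilter_le_nhds (U.map fun t => x (t + s)) ?_
    refine le_principal_iff.2 (hU ?_)
    filter_upwards [eventually_ge_atTop (-s)] with t ht
    exact hball _ (by linarith)
  choose q hqK hq using hlim
  have hq0 : Tendsto x U (𝓝 (q 0)) := by simpa using hq 0
  have hconst : ∀ s, g (q s) = c₀ := fun s =>
    tendsto_nhds_unique ((hg.tendsto _).comp (hq s))
      (hc₀.comp ((tendsto_atTop_add_const_right _ s tendsto_id).mono_left hU))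
  have hrem : ∀ s, 0 ≤ s → ‖q s - q 0 - s • f (q 0)‖ ≤ C * C * r * s ^ 2 := by
    intro s hs
    refine le_of_tendsto (((hq s).sub hq0).sub
      (((hf.continuous.tendsto _).comp hq0).const_smul s)).norm (hU ?_)
    filter_upwards [eventually_ge_atTop (0 : ℝ)] with t ht
    exact norm_sub_sub_smul_le hf hf0 hx hr ht hs
  have hqder : HasDerivWithinAt q (f (q 0)) (Ici 0) 0 := by
    rw [hasDerivWithinAt_iff_isLittleO]
    have h1 : (fun s => q s - q 0 - (s - 0) • f (q 0)) =O[𝓝[Ici 0] (0 : ℝ)]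
        fun s : ℝ => s ^ 2 := by
      refine Asymptotics.IsBigO.of_bound (C * C * r) ?_
      filter_upwards [self_mem_nhdsWithin] with s hs
      simpa using hrem s hs
    have h2 : (fun s : ℝ => s ^ 2) =o[𝓝[Ici 0] (0 : ℝ)] fun s => s - 0 := by
      simpa using (Asymptotics.isLittleO_pow_id (𝕜 := ℝ) one_lt_two).mono nhdsWithin_le_nhds
    exact h1.trans_isLittleO h2
  have hzero : g' (q 0) = 0 := by
    have h1 := hgf q 0 hqder
    simp only [hconst] at h1
    exact (uniqueDiffWithinAt_Ici (0 : ℝ)).eq_deriv _ h1 (hasDerivWithinAt_const _ _ _)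
  have : q 0 = 0 := by
    by_contra h
    exact (hneg _ (hr𝒟 (hqK 0)) h).ne hzero
  rwa [this] at hq0

end Lyapunov

/-! ### Derivatives along curves -/

/-- Chain rule: for a Lipschitz map the directional derivative determines the right derivative along
every curve with the given velocity. -/
theorem HasDirDeriv.comp_hasDerivWithinAt {φ : (Fin n → ℝ) → (Fin m → ℝ)} {C : ℝ≥0}
    (hφ : LipschitzWith C φ) {q : ℝ → (Fin n → ℝ)} {t : ℝ} {d : Fin n → ℝ} {v : Fin m → ℝ}
    (hv : HasDirDeriv φ (q t) d v) (hq : HasDerivWithinAt q d (Ici t) t) :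
    HasDerivWithinAt (fun s => φ (q s)) v (Ici t) t := by
  rw [← hasDerivWithinAt_Ioi_iff_Ici, hasDerivWithinAt_iff_tendsto_slope' self_notMem_Ioi] at hq ⊢
  have hshift : Tendsto (fun s => s - t) (𝓝[>] t) (𝓝[>] 0) := by
    refine tendsto_nhdsWithin_iff.2 ⟨?_, ?_⟩
    · have : Tendsto (fun s => s - t) (𝓝 t) (𝓝 (t - t)) := tendsto_id.sub_const t
      rw [sub_self] at this
      exact this.mono_left nhdsWithin_le_nhds
    · filter_upwards [self_mem_nhdsWithin] with s hs
      simpa using hs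
  have h1 := hv.comp hshift
  have h2 : Tendsto (fun s => (s - t)⁻¹ • (φ (q s) - φ (q t + (s - t) • d))) (𝓝[>] t) (𝓝 0) := by
    have h3 : Tendsto (fun s => C * ‖slope q t s - d‖) (𝓝[>] t) (𝓝 0) := by
      simpa using ((hq.sub_const d).norm).const_mul (C : ℝ)
    refine squeeze_zero_norm' ?_ h3
    filter_upwards [self_mem_nhdsWithin] with s hs
    have hs : 0 < s - t := sub_pos.2 (mem_Ioi.1 hs)
    have h4 : slope q t s - d = (s - t)⁻¹ • (q s - (q t + (s - t) • d)) := by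
      rw [slope_def_module, ← sub_sub, smul_sub _ (q s - q t), smul_smul,
        inv_mul_cancel₀ hs.ne', one_smul]
    rw [h4, norm_smul, norm_smul, mul_left_comm]
    gcongr
    exact hφ.norm_sub_le _ _
  have h3 := h2.add h1
  rw [zero_add] at h3
  refine h3.congr fun s => ?_
  simp only [Function.comp_apply, slope_def_module]
  rw [← smul_add, sub_add_sub_cancel]

theorem hasDerivWithinAt_dotProduct_mulVec {ι : Type*} [Fintype ι] (M : Matrix ι ι ℝ)
    {u : ℝ → ι → ℝ} {u' : ι → ℝ} {s : Set ℝ} {t : ℝ} (hu : HasDerivWithinAt u u' s t) :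
    HasDerivWithinAt (fun r => u r ⬝ᵥ (M *ᵥ u r)) (u' ⬝ᵥ (M *ᵥ u t) + u t ⬝ᵥ (M *ᵥ u')) s t := by
  have hui := hasDerivWithinAt_pi.1 hu
  have hM : ∀ i, HasDerivWithinAt (fun r => (M *ᵥ u r) i) ((M *ᵥ u') i) s t := fun i =>
    HasDerivWithinAt.fun_sum fun j _ => (hui j).const_mul (M i j)
  have := HasDerivWithinAt.fun_sum (u := Finset.univ) fun i _ => (hui i).mul (hM i)
  rw [Finset.sum_add_distrib] at this
  exact this

/-- The derivative of `V` along the velocity `(closedLoop x l, l')` is the quadratic form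
of `N`. -/
theorem V_derivative_eq_Vdot (A : Matrix (Fin n) (Fin n) ℝ) (B : Matrix (Fin n) (Fin k) ℝ)
    (D : Matrix (Fin n) (Fin m) ℝ) (K : Matrix (Fin k) (Fin n) ℝ) (L : Matrix (Fin k) (Fin m) ℝ)
    {P : Matrix (Fin n) (Fin n) ℝ} (hP : P.IsSymm) (Q : Matrix (Fin n) (Fin m) ℝ)
    (R : Matrix (Fin m) (Fin m) ℝ) (x : Fin n → ℝ) (l l' : Fin m → ℝ) :
    Sum.elim (closedLoop A B D K L x l) l' ⬝ᵥ (Matrix.fromBlocks P Q Qᵀ R *ᵥ Sum.elim x l) +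
      Sum.elim x l ⬝ᵥ (Matrix.fromBlocks P Q Qᵀ R *ᵥ Sum.elim (closedLoop A B D K L x l) l') =
    Vdot A B D K L P Q R x l l' := by
  have hT : ∀ {p q : ℕ} (G : Matrix (Fin p) (Fin q) ℝ) (u : Fin q → ℝ) (v : Fin p → ℝ),
      u ⬝ᵥ (Gᵀ *ᵥ v) = (G *ᵥ u) ⬝ᵥ v := fun G u v => by
    rw [Matrix.mulVec_transpose, dotProduct_comm, ← Matrix.dotProduct_mulVec, dotProduct_comm]
  have hT' : ∀ {p q : ℕ} (G : Matrix (Fin p) (Fin q) ℝ) (u : Fin q → ℝ) (v : Fin p → ℝ),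
      (Gᵀ *ᵥ v) ⬝ᵥ u = v ⬝ᵥ (G *ᵥ u) := fun G u v => by
    rw [dotProduct_comm, hT, dotProduct_comm]
  have hPs : ∀ u v, (P *ᵥ u) ⬝ᵥ v = u ⬝ᵥ (P *ᵥ v) := fun u v => by
    conv_lhs => rw [← hP]
    rw [hT']
  simp only [Vdot, N, closedLoop, stateRHS, feedback, Matrix.fromBlocks_mulVec,
    Matrix.fromRows_mulVec, Matrix.fromCols_mulVec, Sum.elim_comp_inl, Sum.elim_comp_inr,
    sumElim_dotProduct_sumElim,
    Matrix.add_mulVec, Matrix.mulVec_add, ← Matrix.mulVec_mulVec, dotProduct_add, add_dotProduct,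
    Matrix.zero_mulVec, dotProduct_zero, hT, hT', hPs]
  ring

/-! ### Stability of the closed loop -/

theorem continuous_V {P : Matrix (Fin n) (Fin n) ℝ} {Q : Matrix (Fin n) (Fin m) ℝ}
    {R : Matrix (Fin m) (Fin m) ℝ} {φ : (Fin n → ℝ) → (Fin m → ℝ)} (hφ : Continuous φ) :
    Continuous fun x => V P Q R x (φ x) := by
  have h : Continuous fun x : Fin n → ℝ => (Sum.elim x (φ x) : Fin n ⊕ Fin m → ℝ) := by
    refine continuous_pi fun i => ?_
    rcases i with i | i
    · exact continuous_apply i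
    · exact (continuous_apply i).comp hφ
  unfold V
  fun_prop

theorem exists_lipschitzWith_mulVec {p q : ℕ} (A : Matrix (Fin p) (Fin q) ℝ) :
    ∃ C : ℝ≥0, LipschitzWith C fun x => A *ᵥ x :=
  ⟨_, (Matrix.toLin' A).toContinuousLinearMap.lipschitz⟩

theorem exists_lipschitzWith_stateRHS {E : Matrix (Fin m) (Fin n) ℝ}
    {F : Matrix (Fin m) (Fin m) ℝ} {c : Fin m → ℝ} (hF : IsPMatrix F)
    (A : Matrix (Fin n) (Fin n) ℝ) (B : Matrix (Fin n) (Fin k) ℝ) (D : Matrix (Fin n) (Fin m) ℝ) :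
    ∃ C : ℝ≥0, LipschitzWith C (fun p : (Fin n → ℝ) × (Fin k → ℝ) =>
      stateRHS A B D p.1 p.2 (contactForce E F c p.1)) := by
  obtain ⟨Cl, hl⟩ := exists_lipschitzWith_contactForce (E := E) (c := c) hF
  obtain ⟨CA, hA⟩ := exists_lipschitzWith_mulVec A
  obtain ⟨CB, hB⟩ := exists_lipschitzWith_mulVec B
  obtain ⟨CD, hD⟩ := exists_lipschitzWith_mulVec D
  exact ⟨_, ((hA.comp LipschitzWith.prod_fst).add (hB.comp LipschitzWith.prod_snd)).add
    (hD.comp (hl.comp LipschitzWith.prod_fst))⟩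

theorem exists_lipschitzWith_feedback {E : Matrix (Fin m) (Fin n) ℝ}
    {F : Matrix (Fin m) (Fin m) ℝ} {c : Fin m → ℝ} (hF : IsPMatrix F)
    (K : Matrix (Fin k) (Fin n) ℝ) (L : Matrix (Fin k) (Fin m) ℝ) :
    ∃ C : ℝ≥0, LipschitzWith C (fun x : Fin n → ℝ => feedback K L x (contactForce E F c x)) := by
  obtain ⟨Cl, hl⟩ := exists_lipschitzWith_contactForce (E := E) (c := c) hF
  obtain ⟨CK, hK⟩ := exists_lipschitzWith_mulVec K
  obtain ⟨CL, hL⟩ := exists_lipschitzWith_mulVec L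
  exact ⟨_, hK.add (hL.comp hl)⟩

theorem exists_lipschitzWith_closedLoop {E : Matrix (Fin m) (Fin n) ℝ}
    {F : Matrix (Fin m) (Fin m) ℝ} {c : Fin m → ℝ} (hF : IsPMatrix F)
    (A : Matrix (Fin n) (Fin n) ℝ) (B : Matrix (Fin n) (Fin k) ℝ) (D : Matrix (Fin n) (Fin m) ℝ)
    (K : Matrix (Fin k) (Fin n) ℝ) (L : Matrix (Fin k) (Fin m) ℝ) :
    ∃ C : ℝ≥0, LipschitzWith C (fun x : Fin n → ℝ =>
      closedLoop A B D K L x (contactForce E F c x)) := by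
  obtain ⟨Cl, hl⟩ := exists_lipschitzWith_contactForce (E := E) (c := c) hF
  obtain ⟨Cu, hu⟩ := exists_lipschitzWith_feedback (E := E) (c := c) hF K L
  obtain ⟨CA, hA⟩ := exists_lipschitzWith_mulVec A
  obtain ⟨CB, hB⟩ := exists_lipschitzWith_mulVec B
  obtain ⟨CD, hD⟩ := exists_lipschitzWith_mulVec D
  exact ⟨_, (hA.add (hB.comp hu)).add (hD.comp hl)⟩

theorem V_hasDerivWithinAt {E : Matrix (Fin m) (Fin n) ℝ} {F : Matrix (Fin m) (Fin m) ℝ}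
    {c : Fin m → ℝ} (hF : IsPMatrix F) (A : Matrix (Fin n) (Fin n) ℝ)
    (B : Matrix (Fin n) (Fin k) ℝ) (D : Matrix (Fin n) (Fin m) ℝ) (K : Matrix (Fin k) (Fin n) ℝ)
    (L : Matrix (Fin k) (Fin m) ℝ) {P : Matrix (Fin n) (Fin n) ℝ} (hP : P.IsSymm)
    (Q : Matrix (Fin n) (Fin m) ℝ) (R : Matrix (Fin m) (Fin m) ℝ) {q : ℝ → Fin n → ℝ} {t : ℝ}
    {v : Fin m → ℝ}
    (hq : HasDerivWithinAt q (closedLoop A B D K L (q t) (contactForce E F c (q t))) (Ici t) t)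
    (hv : HasDirDeriv (contactForce E F c) (q t)
      (closedLoop A B D K L (q t) (contactForce E F c (q t))) v) :
    HasDerivWithinAt (fun s => V P Q R (q s) (contactForce E F c (q s)))
      (Vdot A B D K L P Q R (q t) (contactForce E F c (q t)) v) (Ici t) t := by
  obtain ⟨C, hC⟩ := exists_lipschitzWith_contactForce (E := E) (c := c) hF
  have hl := hv.comp_hasDerivWithinAt hC hq
  have hu : HasDerivWithinAt
      (fun s => (Sum.elim (q s) (contactForce E F c (q s)) : Fin n ⊕ Fin m → ℝ))
      (Sum.elim (closedLoop A B D K L (q t) (contactForce E F c (q t))) v) (Ici t) t := by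
    refine hasDerivWithinAt_pi.2 fun i => ?_
    rcases i with i | i
    · exact hasDerivWithinAt_pi.1 hq i
    · exact hasDerivWithinAt_pi.1 hl i
  rw [← V_derivative_eq_Vdot A B D K L hP]
  exact hasDerivWithinAt_dotProduct_mulVec (Matrix.fromBlocks P Q Qᵀ R) hu

end LCS

theorem theorem1 {n k m : ℕ}
    (A : Matrix (Fin n) (Fin n) ℝ) (B : Matrix (Fin n) (Fin k) ℝ) (D : Matrix (Fin n) (Fin m) ℝ)
    (E : Matrix (Fin m) (Fin n) ℝ) (F : Matrix (Fin m) (Fin m) ℝ) (c : Fin m → ℝ)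
    (hF : LCS.IsPMatrix F) (hc : 0 ≤ c)
    (K : Matrix (Fin k) (Fin n) ℝ) (L : Matrix (Fin k) (Fin m) ℝ) :
    -- `λ(x)` is well defined and directionally differentiable
    (∀ x : Fin n → ℝ, ∃! l : Fin m → ℝ, l ∈ LCS.SOL (E *ᵥ x + c) F) ∧
    (∀ x : Fin n → ℝ, LCS.contactForce E F c x ∈ LCS.SOL (E *ᵥ x + c) F) ∧
    (∀ x d : Fin n → ℝ, ∃ v : Fin m → ℝ, LCS.HasDirDeriv (LCS.contactForce E F c) x d v) ∧
    -- the input is a continuous function of the state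
    Continuous (fun x : Fin n → ℝ => LCS.feedback K L x (LCS.contactForce E F c x)) ∧
    -- the system, with free input and in closed loop, is globally Lipschitz continuous
    (∃ C : ℝ≥0, LipschitzWith C (fun p : (Fin n → ℝ) × (Fin k → ℝ) =>
      LCS.stateRHS A B D p.1 p.2 (LCS.contactForce E F c p.1))) ∧
    (∃ C : ℝ≥0, LipschitzWith C (fun x : Fin n → ℝ =>
      LCS.closedLoop A B D K L x (LCS.contactForce E F c x))) ∧
    -- stability
    (∀ (P : Matrix (Fin n) (Fin n) ℝ) (Q : Matrix (Fin n) (Fin m) ℝ)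
      (R : Matrix (Fin m) (Fin m) ℝ) (𝒟 : Set (Fin n → ℝ)), P.IsSymm → 𝒟 ∈ 𝓝 0 →
      (∀ x ∈ 𝒟, x ≠ 0 → ∀ l : Fin m → ℝ, (x, l) ∈ LCS.graphSOL E F c → 0 < LCS.V P Q R x l) →
      ((∀ x ∈ 𝒟, ∀ l l' : Fin m → ℝ,
          (x, l, l') ∈ LCS.graphSOL' E F c (LCS.closedLoop A B D K L x l) →
          LCS.Vdot A B D K L P Q R x l l' ≤ 0) →
        LCS.LyapunovStable (LCS.closedLoop A B D K L) E F c) ∧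
      ((∀ x ∈ 𝒟, x ≠ 0 → ∀ l l' : Fin m → ℝ,
          (x, l, l') ∈ LCS.graphSOL' E F c (LCS.closedLoop A B D K L x l) →
          LCS.Vdot A B D K L P Q R x l l' < 0) →
        LCS.AsymptoticallyStable (LCS.closedLoop A B D K L) E F c)) := by
  obtain ⟨C, hC⟩ := LCS.exists_lipschitzWith_closedLoop (E := E) (c := c) hF A B D K L
  obtain ⟨C', hC'⟩ := LCS.exists_lipschitzWith_feedback (E := E) (c := c) hF K L
  refine ⟨fun x => hF.existsUnique_mem_SOL _, LCS.contactForce_mem hF,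
    LCS.exists_hasDirDeriv_contactForce hF, hC'.continuous,
    LCS.exists_lipschitzWith_stateRHS hF A B D, ⟨C, hC⟩, ?_⟩
  intro P Q R 𝒟 hP h𝒟 hpos
  have hl0 : LCS.contactForce E F c 0 = 0 := LCS.contactForce_zero hF hc
  let f : (Fin n → ℝ) → (Fin n → ℝ) := fun x =>
    LCS.closedLoop A B D K L x (LCS.contactForce E F c x)
  let g : (Fin n → ℝ) → ℝ := fun x => LCS.V P Q R x (LCS.contactForce E F c x)
  choose l' hl' using fun x => LCS.exists_hasDirDeriv_contactForce (E := E) (c := c) hF x (f x)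
  let g' : (Fin n → ℝ) → ℝ := fun x =>
    LCS.Vdot A B D K L P Q R x (LCS.contactForce E F c x) (l' x)
  have hf0 : f 0 = 0 := by simp [f, hl0, LCS.closedLoop, LCS.stateRHS, LCS.feedback]
  have hg0 : g 0 = 0 := by
    have : (Sum.elim 0 0 : Fin n ⊕ Fin m → ℝ) = 0 := by
      ext i
      cases i <;> rfl
    simp [g, hl0, LCS.V, this]
  obtain ⟨Cl, hCl⟩ := LCS.exists_lipschitzWith_contactForce (E := E) (c := c) hF
  have hg : Continuous g := LCS.continuous_V hCl.continuous
  have hgpos : ∀ y ∈ 𝒟, y ≠ 0 → 0 < g y := fun y hy hy0 =>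
    hpos y hy hy0 _ (LCS.contactForce_mem hF y)
  have hgf : ∀ (q : ℝ → Fin n → ℝ) (t : ℝ), HasDerivWithinAt q (f (q t)) (Set.Ici t) t →
      HasDerivWithinAt (fun s => g (q s)) (g' (q t)) (Set.Ici t) t := fun q t hq =>
    LCS.V_hasDerivWithinAt hF A B D K L hP Q R hq (hl' (q t))
  have htraj : ∀ x l, LCS.IsTrajectory (LCS.closedLoop A B D K L) E F c x l →
      ∀ t, 0 ≤ t → HasDerivWithinAt x (f (x t)) (Set.Ici 0) t := by
    intro x l h t ht
    obtain ⟨h1, h2⟩ := h t ht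
    rwa [LCS.eq_contactForce hF h2] at h1
  have hstab : (∀ y ∈ 𝒟, g' y ≤ 0) → LCS.LyapunovStable (LCS.closedLoop A B D K L) E F c := by
    intro hg'
    refine ⟨⟨_, LCS.contactForce_mem hF 0, hf0⟩, fun ε hε => ?_⟩
    obtain ⟨δ, hδ, h⟩ := LCS.stable_of_derivative_nonpos hg hg0 h𝒟 hgpos hgf hg' hε
    exact ⟨δ, hδ, fun x l hx => h x (htraj x l hx)⟩
  refine ⟨fun H => hstab fun y hy => H y hy _ _ ⟨LCS.contactForce_mem hF y, hl' y⟩, fun H => ?_⟩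
  have hneg : ∀ y ∈ 𝒟, y ≠ 0 → g' y < 0 := fun y hy hy0 =>
    H y hy hy0 _ _ ⟨LCS.contactForce_mem hF y, hl' y⟩
  -- The constant solution at the origin shows that the derivative vanishes there.
  have hg'0 : g' 0 = 0 := by
    have h1 := hgf (fun _ => 0) 0 (by simpa only [hf0] using hasDerivWithinAt_const _ _ _)
    exact (uniqueDiffWithinAt_Ici (0 : ℝ)).eq_deriv _ h1 (hasDerivWithinAt_const _ _ _)
  have hg' : ∀ y ∈ 𝒟, g' y ≤ 0 := fun y hy => by
    by_cases hy0 : y = 0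
    · rw [hy0, hg'0]
    · exact (hneg y hy hy0).le
  obtain ⟨r, hr, hr𝒟⟩ := Metric.nhds_basis_closedBall.mem_iff.1 h𝒟
  obtain ⟨δ, hδ, h⟩ := LCS.stable_of_derivative_nonpos hg hg0 h𝒟 hgpos hgf hg' hr
  exact ⟨hstab hg', δ, hδ, fun x l hx hx0 => LCS.tendsto_zero_of_derivative_neg hC hf0 hg hgf hg'
    hneg (htraj x l hx) hr𝒟 fun t ht => (h x (htraj x l hx) hx0 t ht).le⟩
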